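/- For a unital C*-algebra $B$ and $x\in B$ let $U(x)=\{u^*xu : u\in B \text{ unitary}\}$ be the unitary orbit of $x$ in $B$, and for $x,y\in B$ let $\mathrm{dist}(U(x),U(y))=\inf\{\|x'-y'\| : x'\in U(x),\ y'\in U(y)\}$. For $n\ge 1$ and $a$ in a unital C*-algebra $A$ let $a^{(n)}=1_{M_n}\otimes a\in M_n(A)$ be the diagonal matrix with $n$ diagonal entries equal to $a$. Let $M_{n^\infty}$ be the UHF algebra of type $n^\infty$, that is, the C*-algebraic inductive limit of $\mathbb{C}\to M_n\to M_{n^2}\to\cdots$ along the embeddings $x\mapsto x\otimes 1_{M_n}$, and let $\otimes$ denote the minimal C*-tensor product. **Proposition.** Let $n\ge 1$ be an integer and let $A$ be a unital separable C*-algebra such that $M_{n^\infty}\otimes A\cong A$. Then for all $a,b\in A$, $$\mathrm{dist}(U(a),U(b))=\mathrm{dist}\bigl(U(a^{(n)}),U(b^{(n)})\bigr),$$ where the orbits of $a,b$ are taken in $A$ and those of $a^{(n)},b^{(n)}$ are taken in $M_n(A)$. -/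

import Mathlib

open scoped TensorProduct

noncomputable section

universe u v

/-! ## Completion of a star-algebra in a C*-seminorm -/

/-- A C*-seminorm on a complex unital star-algebra: a submultiplicative seminorm with
`p (x* x) = p x ^ 2`. -/
structure CStarSeminorm (R : Type u) [Ring R] [StarRing R] [Algebra ℂ R] extends
    Seminorm ℂ R where
  mul_le' : ∀ x y : R, toFun (x * y) ≤ toFun x * toFun y
  star_mul_self' : ∀ x : R, toFun (star x * x) = toFun x ^ 2

namespace CStarSeminorm

variable {R : Type u} [Ring R] [StarRing R] [Algebra ℂ R]

theorem le_star (p : CStarSeminorm R) (x : R) : p.toSeminorm x ≤ p.toSeminorm (star x) := by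
  have h1 : p.toSeminorm x ^ 2 ≤ p.toSeminorm (star x) * p.toSeminorm x :=
    (p.star_mul_self' x).symm.le.trans (p.mul_le' (star x) x)
  have h2 : 0 ≤ p.toSeminorm x := apply_nonneg _ _
  have h3 : 0 ≤ p.toSeminorm (star x) := apply_nonneg _ _
  by_contra! h
  nlinarith

theorem map_star (p : CStarSeminorm R) (x : R) : p.toSeminorm (star x) = p.toSeminorm x :=
  le_antisymm (by simpa using p.le_star (star x)) (p.le_star x)

/-- The star-algebra `R`, to be normed by `p`. -/
def Carrier (_p : CStarSeminorm R) : Type u := R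

instance (p : CStarSeminorm R) : SeminormedRing p.Carrier where
  __ := (inferInstanceAs (Ring R) : Ring p.Carrier)
  __ := AddGroupSeminorm.toSeminormedAddCommGroup (E := R) p.toAddGroupSeminorm
  norm_mul_le := p.mul_le'

instance (p : CStarSeminorm R) : NormedAlgebra ℂ p.Carrier where
  __ := (inferInstanceAs (Algebra ℂ R) : Algebra ℂ p.Carrier)
  norm_smul_le a x := (map_smul_eq_mul p.toSeminorm a x).le

instance (p : CStarSeminorm R) : StarRing p.Carrier := inferInstanceAs (StarRing R)
instance [StarModule ℂ R] (p : CStarSeminorm R) : StarModule ℂ p.Carrier :=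
  inferInstanceAs (StarModule ℂ R)

instance (p : CStarSeminorm R) : NormedStarGroup p.Carrier where
  norm_star_le x := (p.map_star x).le

/-- The C*-algebra obtained from `R` by dividing out the kernel of `p` and completing
(the uniform completion does both). -/
def Compl (p : CStarSeminorm R) : Type u := UniformSpace.Completion p.Carrier

namespace Compl

open UniformSpace

variable (p : CStarSeminorm R)

instance : NormedRing p.Compl := inferInstanceAs (NormedRing (Completion p.Carrier))
instance : CompleteSpace p.Compl := inferInstanceAs (CompleteSpace (Completion p.Carrier))
instance : NormedAlgebra ℂ p.Compl where
  __ := (inferInstanceAs (Algebra ℂ (Completion p.Carrier)) : Algebra ℂ p.Compl)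
  norm_smul_le a x := norm_smul_le (α := ℂ) (β := Completion p.Carrier) a x

/-- The canonical map of `R` into its completion. -/
def of (x : p.Carrier) : p.Compl := (x : Completion p.Carrier)

theorem of_add (x y : p.Carrier) : of p (x + y) = of p x + of p y := Completion.coe_add x y
theorem of_mul (x y : p.Carrier) : of p (x * y) = of p x * of p y := Completion.coe_mul x y
theorem of_smul (c : ℂ) (x : p.Carrier) : of p (c • x) = c • of p x := Completion.coe_smul c x
theorem norm_of (x : p.Carrier) : ‖of p x‖ = p.toSeminorm x := Completion.norm_coe x

theorem denseRange_of : DenseRange (of p) := Completion.denseRange_coe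

instance : Star p.Compl := ⟨Completion.map (star : p.Carrier → p.Carrier)⟩

theorem of_star (x : p.Carrier) : of p (star x) = star (of p x) :=
  (Completion.map_coe (star_isometry (E := p.Carrier)).uniformContinuous x).symm

theorem continuous_star' : Continuous (star : p.Compl → p.Compl) := Completion.continuous_map

instance : StarRing p.Compl where
  star_involutive x := by
    induction x using (denseRange_of p).induction_on with
    | hp => exact isClosed_eq ((continuous_star' p).comp (continuous_star' p)) continuous_id
    | ih x => rw [← of_star, ← of_star, star_star]
  star_mul x y := by
    induction x, y using (denseRange_of p).induction_on₂ with
    | hp =>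
      exact isClosed_eq ((continuous_star' p).comp continuous_mul)
        (((continuous_star' p).comp continuous_snd).mul ((continuous_star' p).comp continuous_fst))
    | h x y => rw [← of_mul, ← of_star, ← of_star, ← of_star, star_mul, of_mul]
  star_add x y := by
    induction x, y using (denseRange_of p).induction_on₂ with
    | hp =>
      exact isClosed_eq ((continuous_star' p).comp continuous_add)
        (((continuous_star' p).comp continuous_fst).add ((continuous_star' p).comp continuous_snd))
    | h x y => rw [← of_add, ← of_star, ← of_star, ← of_star, star_add, of_add]

instance [StarModule ℂ R] : StarModule ℂ p.Compl where
  star_smul c x := by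
    induction x using (denseRange_of p).induction_on with
    | hp =>
      exact isClosed_eq ((continuous_star' p).comp (continuous_const_smul c))
        ((continuous_star' p).const_smul (star c))
    | ih x => rw [← of_smul, ← of_star, ← of_star, star_smul, of_smul]

instance : CStarRing p.Compl where
  norm_mul_self_le x := by
    induction x using (denseRange_of p).induction_on with
    | hp =>
      exact isClosed_le (continuous_norm.mul continuous_norm)
        (((continuous_star' p).mul continuous_id).norm)
    | ih x =>
      rw [← of_star, ← of_mul, norm_of, norm_of, ← pow_two]
      exact (p.star_mul_self' x).symm.le

instance [StarModule ℂ R] : CStarAlgebra p.Compl where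

end Compl

end CStarSeminorm

/-! ## The inductive limit of a sequence of C*-algebras -/

namespace SeqLimit

variable (A : ℕ → Type u) [∀ k, CStarAlgebra (A k)] (φ : ∀ k, A k →⋆ₐ[ℂ] A (k + 1))

/-- The star-algebra of all sequences `(x k)` with `x (k + 1) = φ k (x k)` for all large `k`. -/
def threads : StarSubalgebra ℂ (∀ k, A k) where
  carrier := {x | ∃ K, ∀ k, K ≤ k → x (k + 1) = φ k (x k)}
  mul_mem' := by
    rintro x y ⟨K, hK⟩ ⟨L, hL⟩
    exact ⟨max K L, fun k hk => by simp [hK k (by omega), hL k (by omega)]⟩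
  add_mem' := by
    rintro x y ⟨K, hK⟩ ⟨L, hL⟩
    exact ⟨max K L, fun k hk => by simp [hK k (by omega), hL k (by omega)]⟩
  algebraMap_mem' r := ⟨0, fun k _ => (AlgHomClass.commutes (φ k) r).symm⟩
  star_mem' := by
    rintro x ⟨K, hK⟩
    exact ⟨K, fun k hk => by simp [hK k hk, map_star]⟩

/-- `lim ‖x k‖`; the limit exists by `tendsto_norm`. -/
def limNorm (x : threads A φ) : ℝ := Filter.limsup (fun k => ‖x.1 k‖) Filter.atTop

theorem tendsto_norm (x : threads A φ) :
    Filter.Tendsto (fun k => ‖x.1 k‖) Filter.atTop (nhds (limNorm A φ x)) := by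
  obtain ⟨K, hK⟩ := x.2
  have hanti : Antitone fun k => ‖x.1 (k + K)‖ := by
    refine antitone_nat_of_succ_le fun k => ?_
    have h : ∀ m, m = k + K + 1 → ‖x.1 m‖ ≤ ‖x.1 (k + K)‖ := by
      rintro _ rfl
      rw [hK (k + K) (by omega)]
      exact NonUnitalStarAlgHom.norm_apply_le (φ (k + K)) _
    exact h _ (by omega)
  have hlim := tendsto_atTop_ciInf hanti ⟨0, by rintro _ ⟨k, rfl⟩; exact norm_nonneg _⟩
  have hlim' := (Filter.tendsto_add_atTop_iff_nat (f := fun k => ‖x.1 k‖) K).1 hlim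
  rw [limNorm, hlim'.limsup_eq]
  exact hlim'

/-- The C*-seminorm `lim ‖x k‖` on eventually coherent sequences. -/
def seminorm : CStarSeminorm (threads A φ) where
  toFun := limNorm A φ
  map_zero' := tendsto_nhds_unique (tendsto_norm A φ 0) (by simp)
  add_le' x y := le_of_tendsto_of_tendsto' (tendsto_norm A φ (x + y))
    ((tendsto_norm A φ x).add (tendsto_norm A φ y)) fun k => norm_add_le (x.1 k) (y.1 k)
  neg' x := tendsto_nhds_unique (tendsto_norm A φ (-x)) (by simpa using tendsto_norm A φ x)
  smul' c x := tendsto_nhds_unique (tendsto_norm A φ (c • x))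
    (by simpa [norm_smul] using (tendsto_norm A φ x).const_mul ‖c‖)
  mul_le' x y := le_of_tendsto_of_tendsto' (tendsto_norm A φ (x * y))
    ((tendsto_norm A φ x).mul (tendsto_norm A φ y)) fun k => norm_mul_le (x.1 k) (y.1 k)
  star_mul_self' x := tendsto_nhds_unique (tendsto_norm A φ (star x * x))
    (by simpa [CStarRing.norm_star_mul_self, pow_two] using (tendsto_norm A φ x).pow 2)

end SeqLimit

/-- The C*-algebra inductive limit of `A 0 → A 1 → A 2 → ⋯` along the unital star-homomorphisms
`φ k`: the eventually coherent sequences, divided by the null sequences and completed in the norm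
`lim ‖x k‖`. -/
abbrev SeqLimit (A : ℕ → Type u) [∀ k, CStarAlgebra (A k)]
    (φ : ∀ k, A k →⋆ₐ[ℂ] A (k + 1)) : Type u :=
  (SeqLimit.seminorm A φ).Compl

/-! ## The UHF algebra of type `n^∞` -/

section UHF

open scoped ComplexOrder

/-- The C*-algebra of complex `n ^ k × n ^ k` matrices, with rows and columns indexed by the words
of length `k` in `n` letters. -/
abbrev MatPow (n k : ℕ) : Type := CStarMatrix (Fin k → Fin n) (Fin k → Fin n) ℂ

/-- The matrix `x ⊗ 1`, with entries `x (i', j')` at `(i' l, j' l)` and zeros elsewhere. -/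
def MatPow.embedFun (n k : ℕ) (x : MatPow n k) : MatPow n (k + 1) :=
  CStarMatrix.ofMatrix fun i j =>
    if i (Fin.last k) = j (Fin.last k) then x (Fin.init i) (Fin.init j) else 0

theorem MatPow.embedFun_apply (n k : ℕ) (x : MatPow n k) (i j : Fin (k + 1) → Fin n) :
    MatPow.embedFun n k x i j =
      if i (Fin.last k) = j (Fin.last k) then x (Fin.init i) (Fin.init j) else 0 := rfl

theorem MatPow.word_ext_iff {n k : ℕ} (i j : Fin (k + 1) → Fin n) :
    i = j ↔ Fin.init i = Fin.init j ∧ i (Fin.last k) = j (Fin.last k) := by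
  constructor
  · rintro rfl
    simp
  · rintro ⟨h1, h2⟩
    rw [← Fin.snoc_init_self i, ← Fin.snoc_init_self j, h1, h2]

/-- The unital embedding `x ↦ x ⊗ 1` of the `n ^ k × n ^ k` matrices into the
`n ^ (k + 1) × n ^ (k + 1)` matrices; the last letter of a word is the new tensor factor. -/
def MatPow.embed (n k : ℕ) : MatPow n k →⋆ₐ[ℂ] MatPow n (k + 1) where
  toFun := MatPow.embedFun n k
  map_one' := by
    ext i j
    simp only [MatPow.embedFun_apply, CStarMatrix.one_apply, MatPow.word_ext_iff i j]
    split_ifs <;> simp_all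
  map_mul' x y := by
    ext i j
    simp only [CStarMatrix.mul_apply, MatPow.embedFun_apply]
    rw [← (Fin.snocEquiv fun _ => Fin n).sum_comp, Fintype.sum_prod_type, Finset.sum_comm]
    simp only [Fin.snocEquiv, Equiv.coe_fn_mk, Fin.snoc_last, Fin.init_snoc]
    split_ifs with h
    · refine Finset.sum_congr rfl fun w _ => ?_
      simp [h]
    · symm
      refine Finset.sum_eq_zero fun w _ => Finset.sum_eq_zero fun l _ => ?_
      split_ifs <;> simp_all
  map_zero' := by
    ext i j
    simp [MatPow.embedFun_apply]
  map_add' x y := by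
    ext i j
    simp only [CStarMatrix.add_apply, MatPow.embedFun_apply]
    split_ifs <;> simp
  commutes' r := by
    ext i j
    simp only [MatPow.embedFun_apply, CStarMatrix.algebraMap_apply, MatPow.word_ext_iff i j]
    split_ifs <;> simp_all
  map_star' x := by
    ext i j
    simp only [CStarMatrix.star_apply, MatPow.embedFun_apply, eq_comm (a := j (Fin.last k))]
    split_ifs <;> simp

/-- The UHF algebra of type `n^∞`: the inductive limit of the matrix algebras of sizes
`1, n, n ^ 2, …` along the embeddings `x ↦ x ⊗ 1`. -/
abbrev UHF (n : ℕ) : Type := SeqLimit (MatPow n) (MatPow.embed n)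

end UHF

/-! ## The minimal tensor product -/

section MinTensor

open UniformSpace

variable {H : Type u} {K : Type v}
  [NormedAddCommGroup H] [InnerProductSpace ℂ H]
  [NormedAddCommGroup K] [InnerProductSpace ℂ K]

variable (H K) in
/-- The Hilbert space tensor product: the completion of the algebraic tensor product in the inner
product with `⟪ξ ⊗ η, ξ' ⊗ η'⟫ = ⟪ξ, ξ'⟫ ⟪η, η'⟫`. -/
def HilbertTensor : Type (max u v) := Completion (H ⊗[ℂ] K)

instance : NormedAddCommGroup (HilbertTensor H K) :=
  inferInstanceAs (NormedAddCommGroup (Completion (H ⊗[ℂ] K)))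
instance : InnerProductSpace ℂ (HilbertTensor H K) :=
  inferInstanceAs (InnerProductSpace ℂ (Completion (H ⊗[ℂ] K)))
instance : CompleteSpace (HilbertTensor H K) :=
  inferInstanceAs (CompleteSpace (Completion (H ⊗[ℂ] K)))

/-- The canonical embedding of the algebraic tensor product. -/
def HilbertTensor.of : H ⊗[ℂ] K →L[ℂ] HilbertTensor H K :=
  (Completion.toComplL : H ⊗[ℂ] K →L[ℂ] Completion (H ⊗[ℂ] K))

theorem HilbertTensor.denseRange_of : DenseRange (HilbertTensor.of : H ⊗[ℂ] K → HilbertTensor H K) :=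
  Completion.denseRange_coe

theorem HilbertTensor.inner_of (x y : H ⊗[ℂ] K) :
    inner ℂ (HilbertTensor.of x) (HilbertTensor.of y) = inner ℂ x y := Completion.inner_coe x y

theorem HilbertTensor.norm_of (x : H ⊗[ℂ] K) : ‖HilbertTensor.of x‖ = ‖x‖ := Completion.norm_coe x

/-- The bounded operator `S ⊗ T` on the Hilbert space tensor product. -/
def opTensor (S : H →L[ℂ] H) (T : K →L[ℂ] K) : HilbertTensor H K →L[ℂ] HilbertTensor H K :=
  ((TensorProduct.mapL S T).completion : Completion (H ⊗[ℂ] K) →L[ℂ] Completion (H ⊗[ℂ] K))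

theorem opTensor_of (S : H →L[ℂ] H) (T : K →L[ℂ] K) (x : H ⊗[ℂ] K) :
    opTensor S T (HilbertTensor.of x) =
      HilbertTensor.of (TensorProduct.map S.toLinearMap T.toLinearMap x) :=
  (ContinuousLinearMap.completion_apply_coe (TensorProduct.mapL S T) x).trans
    (congrArg HilbertTensor.of (TensorProduct.mapL_apply S T x))

/-- Operators on the Hilbert space tensor product that agree on elementary tensors are equal. -/
theorem HilbertTensor.ext_op {S T : HilbertTensor H K →L[ℂ] HilbertTensor H K}
    (h : ∀ (ξ : H) (η : K), S (HilbertTensor.of (ξ ⊗ₜ η)) = T (HilbertTensor.of (ξ ⊗ₜ η))) :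
    S = T := by
  ext x
  induction x using HilbertTensor.denseRange_of.induction_on with
  | hp => exact isClosed_eq S.continuous T.continuous
  | ih x =>
    induction x using TensorProduct.induction_on with
    | zero => simp
    | tmul ξ η => exact h ξ η
    | add x y hx hy => simp only [map_add, hx, hy]

theorem opTensor_tmul (S : H →L[ℂ] H) (T : K →L[ℂ] K) (ξ : H) (η : K) :
    opTensor S T (HilbertTensor.of (ξ ⊗ₜ η)) = HilbertTensor.of (S ξ ⊗ₜ T η) := by
  simp [opTensor_of]

theorem norm_opTensor_le (S : H →L[ℂ] H) (T : K →L[ℂ] K) : ‖opTensor S T‖ ≤ ‖S‖ * ‖T‖ := by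
  refine ContinuousLinearMap.opNorm_le_bound _ (by positivity) fun x => ?_
  induction x using HilbertTensor.denseRange_of.induction_on with
  | hp => apply isClosed_le <;> fun_prop
  | ih x =>
    have h : opTensor S T (HilbertTensor.of x) = HilbertTensor.of (TensorProduct.mapL S T x) := by
      simp [opTensor_of]
    rw [h, HilbertTensor.norm_of, HilbertTensor.norm_of]
    exact (TensorProduct.mapL S T).le_of_opNorm_le (TensorProduct.norm_mapL_le S T) x

theorem opTensor_mul (S S' : H →L[ℂ] H) (T T' : K →L[ℂ] K) :
    opTensor (S * S') (T * T') = opTensor S T * opTensor S' T' :=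
  HilbertTensor.ext_op fun ξ η => by simp [opTensor_tmul]

theorem opTensor_star [CompleteSpace H] [CompleteSpace K] (S : H →L[ℂ] H) (T : K →L[ℂ] K) :
    opTensor (star S) (star T) = star (opTensor S T) := by
  refine (ContinuousLinearMap.eq_adjoint_iff _ _).2 fun x y => ?_
  induction x, y using HilbertTensor.denseRange_of.induction_on₂ with
  | hp => apply isClosed_eq <;> fun_prop
  | h x y =>
    rw [opTensor_of, opTensor_of, HilbertTensor.inner_of, HilbertTensor.inner_of]
    induction x using TensorProduct.induction_on with
    | zero => simp
    | add x x' hx hx' => simp only [map_add, inner_add_left, hx, hx']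
    | tmul ξ η =>
      induction y using TensorProduct.induction_on with
      | zero => simp
      | add y y' hy hy' => simp only [map_add, inner_add_right, hy, hy']
      | tmul ξ' η' =>
        simp [ContinuousLinearMap.star_eq_adjoint, ContinuousLinearMap.adjoint_inner_left]

variable [CompleteSpace H] [CompleteSpace K]
  {A : Type u} {B : Type v} [CStarAlgebra A] [CStarAlgebra B]

/-- The tensor product `π ⊗ σ` of two representations on Hilbert spaces: the unital
star-representation of the algebraic tensor product with `(π ⊗ σ) (a ⊗ b) = π a ⊗ σ b`. -/
def repTensor (π : A →⋆ₐ[ℂ] (H →L[ℂ] H)) (σ : B →⋆ₐ[ℂ] (K →L[ℂ] K)) :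
    A ⊗[ℂ] B →⋆ₐ[ℂ] (HilbertTensor H K →L[ℂ] HilbertTensor H K) :=
  let l : A ⊗[ℂ] B →ₗ[ℂ] (HilbertTensor H K →L[ℂ] HilbertTensor H K) :=
    TensorProduct.lift <| LinearMap.mk₂ ℂ (fun a b => opTensor (π a) (σ b))
      (fun a a' b => HilbertTensor.ext_op fun ξ η => by
        simp [opTensor_tmul, TensorProduct.add_tmul])
      (fun c a b => HilbertTensor.ext_op fun ξ η => by
        simp [opTensor_tmul, ← TensorProduct.smul_tmul'])
      (fun a b b' => HilbertTensor.ext_op fun ξ η => by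
        simp [opTensor_tmul, TensorProduct.tmul_add])
      (fun c a b => HilbertTensor.ext_op fun ξ η => by
        simp [opTensor_tmul])
  have hl : ∀ a b, l (a ⊗ₜ b) = opTensor (π a) (σ b) := fun a b => by simp [l]
  { Algebra.TensorProduct.algHomOfLinearMapTensorProduct l
      (fun a a' b b' => by simp only [hl, map_mul, opTensor_mul])
      (by
        rw [hl, map_one, map_one]
        exact HilbertTensor.ext_op fun ξ η => by simp [opTensor_tmul]) with
    map_star' := fun x => by
      change l (star x) = star (l x)
      induction x using TensorProduct.induction_on with
      | zero => simp
      | tmul a b => rw [TensorProduct.star_tmul, hl, hl, map_star, map_star, opTensor_star]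
      | add x y hx hy => simp only [star_add, map_add, hx, hy] }

theorem repTensor_tmul (π : A →⋆ₐ[ℂ] (H →L[ℂ] H)) (σ : B →⋆ₐ[ℂ] (K →L[ℂ] K)) (a : A) (b : B) :
    repTensor π σ (a ⊗ₜ b) = opTensor (π a) (σ b) := by
  simp [repTensor]

/-- The values `‖(π ⊗ σ) x‖`, over all representations `π` of `A` and `σ` of `B` on Hilbert
spaces. -/
def spatialValues (x : A ⊗[ℂ] B) : Set ℝ :=
  {r | ∃ (H : Type u) (_ : NormedAddCommGroup H) (_ : InnerProductSpace ℂ H) (_ : CompleteSpace H)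
      (K : Type v) (_ : NormedAddCommGroup K) (_ : InnerProductSpace ℂ K) (_ : CompleteSpace K)
      (π : A →⋆ₐ[ℂ] (H →L[ℂ] H)) (σ : B →⋆ₐ[ℂ] (K →L[ℂ] K)), r = ‖repTensor π σ x‖}

/-- The minimal (spatial) norm `‖x‖ = sup ‖(π ⊗ σ) x‖`, over all representations `π` of `A` and
`σ` of `B` on Hilbert spaces. -/
def minNorm (x : A ⊗[ℂ] B) : ℝ := sSup (spatialValues x)

theorem bddAbove_spatialValues (x : A ⊗[ℂ] B) : BddAbove (spatialValues x) := by
  induction x using TensorProduct.induction_on with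
  | zero => exact ⟨0, by rintro _ ⟨H, _, _, _, K, _, _, _, π, σ, rfl⟩; simp⟩
  | tmul a b =>
    refine ⟨‖a‖ * ‖b‖, ?_⟩
    rintro _ ⟨H, _, _, _, K, _, _, _, π, σ, rfl⟩
    rw [repTensor_tmul]
    refine (norm_opTensor_le _ _).trans ?_
    gcongr
    · exact NonUnitalStarAlgHom.norm_apply_le π a
    · exact NonUnitalStarAlgHom.norm_apply_le σ b
  | add x y hx hy =>
    obtain ⟨C, hC⟩ := hx
    obtain ⟨D, hD⟩ := hy
    refine ⟨C + D, ?_⟩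
    rintro _ ⟨H, _, _, _, K, _, _, _, π, σ, rfl⟩
    rw [map_add]
    exact (norm_add_le _ _).trans (add_le_add (hC ⟨H, _, _, _, K, _, _, _, π, σ, rfl⟩)
      (hD ⟨H, _, _, _, K, _, _, _, π, σ, rfl⟩))

theorem norm_repTensor_le (π : A →⋆ₐ[ℂ] (H →L[ℂ] H)) (σ : B →⋆ₐ[ℂ] (K →L[ℂ] K))
    (x : A ⊗[ℂ] B) : ‖repTensor π σ x‖ ≤ minNorm x :=
  le_csSup (bddAbove_spatialValues x) ⟨H, _, _, _, K, _, _, _, π, σ, rfl⟩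

theorem minNorm_nonneg (x : A ⊗[ℂ] B) : 0 ≤ minNorm x :=
  Real.sSup_nonneg <| by
    rintro _ ⟨H, _, _, _, K, _, _, _, π, σ, rfl⟩
    exact norm_nonneg _

theorem minNorm_le {x : A ⊗[ℂ] B} {C : ℝ} (hC : 0 ≤ C)
    (h : ∀ (H : Type u) [NormedAddCommGroup H] [InnerProductSpace ℂ H] [CompleteSpace H]
      (K : Type v) [NormedAddCommGroup K] [InnerProductSpace ℂ K] [CompleteSpace K]
      (π : A →⋆ₐ[ℂ] (H →L[ℂ] H)) (σ : B →⋆ₐ[ℂ] (K →L[ℂ] K)), ‖repTensor π σ x‖ ≤ C) :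
    minNorm x ≤ C :=
  Real.sSup_le (by
    rintro _ ⟨H, _, _, _, K, _, _, _, π, σ, rfl⟩
    exact h H K π σ) hC

theorem minNorm_smul_le (c : ℂ) (x : A ⊗[ℂ] B) : minNorm (c • x) ≤ ‖c‖ * minNorm x :=
  minNorm_le (mul_nonneg (norm_nonneg _) (minNorm_nonneg _)) fun H _ _ _ K _ _ _ π σ => by
    rw [map_smul, norm_smul]
    exact mul_le_mul_of_nonneg_left (norm_repTensor_le π σ x) (norm_nonneg _)

variable (A B) in
/-- The minimal norm as a C*-seminorm on the algebraic tensor product. -/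
def minSeminorm : CStarSeminorm (A ⊗[ℂ] B) where
  toSeminorm := Seminorm.ofSMulLE minNorm
    (le_antisymm (minNorm_le le_rfl fun H _ _ _ K _ _ _ π σ => by simp) (minNorm_nonneg _))
    (fun x y => minNorm_le (add_nonneg (minNorm_nonneg _) (minNorm_nonneg _))
      fun H _ _ _ K _ _ _ π σ => by
        rw [map_add]
        exact (norm_add_le _ _).trans
          (add_le_add (norm_repTensor_le π σ x) (norm_repTensor_le π σ y)))
    minNorm_smul_le
  mul_le' x y := minNorm_le (mul_nonneg (minNorm_nonneg _) (minNorm_nonneg _))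
    fun H _ _ _ K _ _ _ π σ => by
      rw [map_mul]
      exact (norm_mul_le _ _).trans (mul_le_mul (norm_repTensor_le π σ x)
        (norm_repTensor_le π σ y) (norm_nonneg _) (minNorm_nonneg _))
  star_mul_self' x := by
    change minNorm (star x * x) = minNorm x ^ 2
    refine le_antisymm (minNorm_le (sq_nonneg _) fun H _ _ _ K _ _ _ π σ => ?_) ?_
    · rw [map_mul, map_star, CStarRing.norm_star_mul_self, ← pow_two]
      exact pow_le_pow_left₀ (norm_nonneg _) (norm_repTensor_le π σ x) 2
    · refine (Real.le_sqrt (minNorm_nonneg _) (minNorm_nonneg _)).1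
        (minNorm_le (Real.sqrt_nonneg _) fun H _ _ _ K _ _ _ π σ => ?_)
      refine Real.le_sqrt_of_sq_le ?_
      rw [pow_two, ← CStarRing.norm_star_mul_self, ← map_star, ← map_mul]
      exact norm_repTensor_le π σ _

variable (A B) in
/-- The minimal tensor product of two unital C*-algebras: the completion of the algebraic tensor
product in the minimal norm. -/
abbrev MinTensorProduct : Type (max u v) := (minSeminorm A B).Compl

end MinTensor

/-! ## Unitary orbits and matrix amplifications -/

section Orbits

variable {A : Type u} [CStarAlgebra A]

/-- The unitary orbit `{u* a u | u unitary}`. -/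
def unitaryOrbit (a : A) : Set A := {x | ∃ u ∈ unitary A, x = star u * a * u}

/-- The distance `inf ‖x - y‖` between the unitary orbits of `a` and `b`. -/
def orbitDist (a b : A) : ℝ :=
  sInf {r | ∃ x ∈ unitaryOrbit a, ∃ y ∈ unitaryOrbit b, r = ‖x - y‖}

/-- The amplification `a^(n)`: the diagonal `n × n` matrix with all diagonal entries `a`. -/
def amplify (n : ℕ) (a : A) : CStarMatrix (Fin n) (Fin n) A :=
  CStarMatrix.ofMatrix (Matrix.diagonal fun _ => a)

end Orbits

end

/-! Since `A ≅ UHF n ⊗ A`, the matrix units of the successive tensor factors of the UHF algebra give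
systems `f k` of `n × n` matrix units in `A` such that a dense set of elements of `A` commutes with
`f k` for all large `k`.

If all entries of a matrix `Z` commute with a system `f`, then `Z ↦ ∑ f i j * Z i j` is a unital
star-homomorphism (`IsMatrixUnits.collapse`). It is contractive and sends `a^(n)` back to `a`. It
cannot be applied to an arbitrary unitary `W` of the matrix algebra, but `W`, `a`, `b` can be
approximated by `Z`, `a'`, `b'` that commute with some `f k`. Collapsing `Z` yields an almost
unitary `z` in `A` with `‖z* a' z - b'‖` at most slightly larger than `‖W* a^(n) W - b^(n)‖`, and
the polar decomposition (`exists_unitary_norm_sub_le`) replaces `z` by a unitary nearby. This is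
`orbitDist_amplify_of_dense`. The opposite inequality holds because amplification is itself a
contractive unital star-homomorphism. -/

noncomputable section

/-! ## Almost unitary elements -/

section Polar

variable {A : Type*} [CStarAlgebra A]

/-- The unitary part in the polar decomposition of an almost unitary element is close to it. -/
theorem exists_unitary_norm_sub_le {z : A} {δ : ℝ} (hδ : δ < 1) (h₁ : ‖star z * z - 1‖ ≤ δ)
    (h₂ : ‖z * star z - 1‖ < 1) : ∃ w ∈ unitary A, ‖w - z‖ ≤ δ := by
  have hδ0 : 0 ≤ δ := (norm_nonneg _).trans h₁
  set h := star z * z with hh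
  have hsa : IsSelfAdjoint h := IsSelfAdjoint.star_mul_self z
  have hspec : ∀ t ∈ spectrum ℝ h, |t - 1| ≤ δ := fun t ht => by
    have h3 := norm_apply_le_norm_cfc (fun t : ℝ => t - 1) h ht
    rw [cfc_sub _ _ h, cfc_id' ℝ h, cfc_const_one ℝ h] at h3
    exact h3.trans h₁
  have hpos : ∀ t ∈ spectrum ℝ h, 0 < t := fun t ht => by
    have := abs_le.1 (hspec t ht)
    linarith
  set g : ℝ → ℝ := fun t => (√t)⁻¹ with hg
  have hgc : ContinuousOn g (spectrum ℝ h) :=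
    Real.continuous_sqrt.continuousOn.inv₀ fun t ht => (Real.sqrt_pos.2 (hpos t ht)).ne'
  set s := cfc g h with hs
  have hss : star s = s := (cfc_predicate g h : IsSelfAdjoint s)
  have hcomm : Commute h s := by
    simpa only [cfc_id ℝ h] using cfc_commute_cfc id g h
  have hsh : h * (s * s) = 1 := by
    calc h * (s * s) = cfc (fun t : ℝ => t) h * (cfc g h * cfc g h) := by rw [cfc_id' ℝ h]
      _ = cfc (fun t => t * (g t * g t)) h := by
        rw [← cfc_mul g g h hgc hgc,
          ← cfc_mul (fun t => t) (fun t => g t * g t) h continuousOn_id (hgc.mul hgc)]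
      _ = 1 := by
        rw [cfc_congr (g := fun _ => 1), cfc_const_one ℝ h]
        intro t ht
        have := hpos t ht
        simp only [hg, ← mul_inv, Real.mul_self_sqrt this.le]
        exact mul_inv_cancel₀ this.ne'
  have hgc1 : ContinuousOn (fun t => g t - 1) (spectrum ℝ h) := hgc.sub continuousOn_const
  have hsub : ‖z * s - z‖ ^ 2 ≤ δ ^ 2 := by
    -- By the C*-identity it suffices to bound `(s - 1) h (s - 1)`, which is `(√t - 1) ^ 2`
    -- evaluated at `h`; and `|√t - 1| ≤ |√t - 1| (√t + 1) = |t - 1| ≤ δ`.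
    have h3 : star (z * s - z) * (z * s - z) = cfc (fun t => (g t - 1) * (t * (g t - 1))) h := by
      rw [cfc_mul (fun t => g t - 1) (fun t => t * (g t - 1)) h hgc1 (continuousOn_id.mul hgc1),
        cfc_mul (fun t => t) (fun t => g t - 1) h continuousOn_id hgc1,
        cfc_sub _ _ h hgc continuousOn_const, cfc_id' ℝ h, cfc_const_one ℝ h, ← hs, star_sub,
        star_mul, hss, hh]
      noncomm_ring
    rw [pow_two, ← CStarRing.norm_star_mul_self, h3]
    refine norm_cfc_le (sq_nonneg _) fun t ht => ?_
    have ht0 := hpos t ht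
    have hr := Real.sqrt_pos.2 ht0
    have h4 : (g t - 1) * (t * (g t - 1)) = (√t - 1) ^ 2 := by
      simp only [hg]
      nth_rw 2 [← Real.mul_self_sqrt ht0.le]
      field_simp
      ring
    rw [h4, Real.norm_of_nonneg (sq_nonneg _)]
    refine sq_le_sq.2 (le_trans ?_ ((hspec t ht).trans (le_abs_self δ)))
    have h5 : t - 1 = (√t - 1) * (√t + 1) := by nlinarith [Real.mul_self_sqrt ht0.le]
    rw [h5, abs_mul]
    exact le_mul_of_one_le_right (abs_nonneg _) (by rw [abs_of_pos (by linarith)]; linarith)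
  -- Invertibility of `h` alone makes `z * s` only an isometry; `h₂` supplies a right inverse of
  -- `z`.
  obtain ⟨w, hw⟩ : ∃ w, z * w = 1 := by
    have h3 : IsUnit (z * star z) := by
      have := isUnit_one_sub_of_norm_lt_one (x := 1 - z * star z) (by rwa [norm_sub_rev])
      simpa using this
    obtain ⟨y, hy⟩ := h3.exists_right_inv
    exact ⟨star z * y, by rwa [← mul_assoc]⟩
  have hwz : star w * star z = 1 := by rw [← star_mul, hw, star_one]
  refine ⟨z * s, Unitary.mem_iff.2 ⟨?_, ?_⟩, abs_le_of_sq_le_sq' hsub hδ0 |>.2⟩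
  · rw [star_mul, hss, mul_assoc, ← mul_assoc (star z), ← hh, hcomm.eq, ← mul_assoc,
      ← (hcomm.mul_right hcomm).eq, hsh]
  -- `star w` is a left and `z * (s * s)` a right inverse of `star z`, so they agree.
  · have h4 : star w = z * (s * s) := left_inv_eq_right_inv hwz (by rw [← mul_assoc, ← hh, hsh])
    rw [star_mul, hss, ← mul_assoc, mul_assoc z s s, ← h4, hwz]

end Polar

/-! ## Systems of matrix units -/

/-- A system of `n × n` matrix units in a unital star-ring. -/
structure IsMatrixUnits {A : Type*} [Ring A] [StarRing A] {n : ℕ} (f : Fin n → Fin n → A) :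
    Prop where
  mul : ∀ i j k l, f i j * f k l = if j = k then f i l else 0
  star : ∀ i j, star (f i j) = f j i
  sum_diag : ∑ i, f i i = 1

theorem amplify_apply {A : Type u} [CStarAlgebra A] (n : ℕ) (a : A) (i j : Fin n) :
    amplify n a i j = if i = j then a else 0 := rfl

section Amplify

variable {A : Type u} [CStarAlgebra A]

theorem amplify_mul_apply (n : ℕ) (a : A) (Z : CStarMatrix (Fin n) (Fin n) A) (i j : Fin n) :
    (amplify n a * Z) i j = a * Z i j := by
  simp [CStarMatrix.mul_apply, amplify_apply]

theorem mul_amplify_apply (n : ℕ) (a : A) (Z : CStarMatrix (Fin n) (Fin n) A) (i j : Fin n) :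
    (Z * amplify n a) i j = Z i j * a := by
  simp [CStarMatrix.mul_apply, amplify_apply]

/-- The amplification `a ↦ a^(n)` as a star-homomorphism. -/
def amplifyHom (n : ℕ) : A →⋆ₐ[ℂ] CStarMatrix (Fin n) (Fin n) A where
  toFun := amplify n
  map_one' := rfl
  map_mul' a b := by
    ext i j
    rw [amplify_mul_apply]
    simp [amplify_apply]
  map_zero' := by
    ext i j
    simp [amplify_apply]
  map_add' a b := by
    ext i j
    simp only [CStarMatrix.add_apply, amplify_apply]
    split_ifs <;> simp
  commutes' r := by
    ext i j
    simp [amplify_apply, CStarMatrix.algebraMap_apply]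
  map_star' a := by
    ext i j
    simp only [CStarMatrix.star_apply, amplify_apply, eq_comm (a := j)]
    split_ifs <;> simp

theorem amplifyHom_apply (n : ℕ) (a : A) : amplifyHom n a = amplify n a := rfl

variable {n : ℕ} (f : Fin n → Fin n → A)

/-- The matrices over `A` all of whose entries commute with all `f i j`. -/
def entryCommutant : StarSubalgebra ℂ (CStarMatrix (Fin n) (Fin n) A) :=
  StarSubalgebra.centralizer ℂ (Set.range fun p : Fin n × Fin n => amplify n (f p.1 p.2))

variable {f}

/-- Multiplying by `amplify n c` multiplies every entry by `c`. The star-centralizer also asks for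
commutation with adjoints, which adds nothing because `star (f p q) = f q p`. -/
theorem mem_entryCommutant (hf : IsMatrixUnits f) {Z : CStarMatrix (Fin n) (Fin n) A} :
    Z ∈ entryCommutant f ↔ ∀ p q i j, Commute (f p q) (Z i j) := by
  have key : ∀ p q, (∀ i j, Commute (f p q) (Z i j)) ↔
      amplify n (f p q) * Z = Z * amplify n (f p q) := fun p q => by
    simp only [← CStarMatrix.ext_iff, amplify_mul_apply, mul_amplify_apply]
    rfl
  simp only [key]
  rw [entryCommutant, StarSubalgebra.mem_centralizer_iff]
  constructor
  · exact fun h p q => (h _ ⟨(p, q), rfl⟩).1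
  · rintro h _ ⟨⟨p, q⟩, rfl⟩
    refine ⟨h p q, ?_⟩
    change star (amplifyHom n (f p q)) * Z = Z * star (amplifyHom n (f p q))
    rw [← map_star, hf.star]
    exact h q p

theorem IsMatrixUnits.commute_entry (hf : IsMatrixUnits f) (Z : entryCommutant f)
    (p q i j : Fin n) : f p q * Z.1 i j = Z.1 i j * f p q :=
  (mem_entryCommutant hf).1 Z.2 p q i j

/-- The homomorphism `Z ↦ ∑ i j, f i j * Z i j`, for matrix units `f` commuting with all
entries. -/
def IsMatrixUnits.collapse (hf : IsMatrixUnits f) : entryCommutant f →⋆ₐ[ℂ] A where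
  toFun Z := ∑ i, ∑ j, f i j * Z.1 i j
  map_one' := by
    simp [CStarMatrix.one_apply, hf.sum_diag]
  map_mul' Z W := by
    -- Moving `Z i j` past `f k l` brings two matrix units together; what remains is the matrix
    -- product up to the order of summation.
    have h1 : ∀ i j k l, (f i j * Z.1 i j) * (f k l * W.1 k l) =
        if j = k then f i l * (Z.1 i j * W.1 k l) else 0 := fun i j k l => by
      rw [mul_assoc, ← mul_assoc (Z.1 i j), ← hf.commute_entry, mul_assoc, ← mul_assoc, hf.mul]
      split_ifs <;> simp
    simp only [Finset.sum_mul, Finset.mul_sum, h1]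
    simp [CStarMatrix.mul_apply, Finset.mul_sum]
    rw [Finset.sum_comm]
    symm
    rw [Finset.sum_comm]
    exact Finset.sum_congr rfl fun j _ => Finset.sum_comm
  map_zero' := by simp
  map_add' Z W := by simp [mul_add, Finset.sum_add_distrib]
  commutes' r := by
    simp [CStarMatrix.algebraMap_apply, ← Finset.sum_mul, hf.sum_diag]
  map_star' Z := by
    simp only [star_sum, star_mul, hf.star, StarMemClass.coe_star, CStarMatrix.star_apply]
    rw [Finset.sum_comm]
    refine Finset.sum_congr rfl fun i _ => Finset.sum_congr rfl fun j _ => ?_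
    exact hf.commute_entry (Star.star Z) j i j i

theorem IsMatrixUnits.collapse_amplify (hf : IsMatrixUnits f) {a : A}
    (ha : amplify n a ∈ entryCommutant f) : hf.collapse ⟨amplify n a, ha⟩ = a := by
  change ∑ i, ∑ j, f i j * amplify n a i j = a
  simp [amplify_apply, ← Finset.sum_mul, hf.sum_diag]

theorem amplify_mem_entryCommutant (hf : IsMatrixUnits f) {a : A}
    (ha : ∀ i j, Commute (f i j) a) : amplify n a ∈ entryCommutant f :=
  (mem_entryCommutant hf).2 fun p q i j => by
    rw [amplify_apply]
    split_ifs
    exacts [ha p q, Commute.zero_right _]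

variable [PartialOrder A] [StarOrderedRing A]

theorem norm_amplify_le (n : ℕ) (a : A) : ‖amplify n a‖ ≤ ‖a‖ :=
  NonUnitalStarAlgHom.norm_apply_le (amplifyHom n) a

theorem continuous_amplify (n : ℕ) : Continuous (amplify n : A → _) :=
  AddMonoidHomClass.continuous_of_bound (amplifyHom n) 1 fun a => by
    rw [one_mul]
    exact norm_amplify_le n a

theorem isClosed_entryCommutant (f : Fin n → Fin n → A) :
    IsClosed (entryCommutant f : Set (CStarMatrix (Fin n) (Fin n) A)) :=
  Set.isClosed_centralizer _

/-- A closed star-subalgebra is a C*-algebra, and star-homomorphisms between C*-algebras are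
contractive. -/
theorem IsMatrixUnits.norm_collapse_le (hf : IsMatrixUnits f) (Z : entryCommutant f) :
    ‖hf.collapse Z‖ ≤ ‖Z.1‖ :=
  haveI := isClosed_entryCommutant f
  NonUnitalStarAlgHom.norm_apply_le hf.collapse Z

end Amplify

/-! ## Distances of unitary orbits -/

section OrbitDist

variable {A : Type u} [CStarAlgebra A]

theorem orbitDist_le {a b u v : A} (hu : u ∈ unitary A) (hv : v ∈ unitary A) :
    orbitDist a b ≤ ‖star u * a * u - star v * b * v‖ :=
  csInf_le ⟨0, by rintro _ ⟨x, -, y, -, rfl⟩; exact norm_nonneg _⟩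
    ⟨_, ⟨u, hu, rfl⟩, _, ⟨v, hv, rfl⟩, rfl⟩

theorem le_orbitDist {a b : A} {c : ℝ}
    (h : ∀ u ∈ unitary A, ∀ v ∈ unitary A, c ≤ ‖star u * a * u - star v * b * v‖) :
    c ≤ orbitDist a b := by
  refine le_csInf ⟨_, a, ⟨1, one_mem _, by simp⟩, b, ⟨1, one_mem _, by simp⟩, rfl⟩ ?_
  rintro _ ⟨_, ⟨u, hu, rfl⟩, _, ⟨v, hv, rfl⟩, rfl⟩
  exact h u hu v hv

/-- Conjugation by `v` is isometric and carries `v* b v` to `b`, so a single unitary suffices to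
compare two orbits. -/
theorem norm_unitary_conj_sub_unitary_conj {a b u v : A} (hv : v ∈ unitary A) :
    ‖star u * a * u - star v * b * v‖ = ‖star (u * star v) * a * (u * star v) - b‖ := by
  obtain ⟨hv1, hv2⟩ := Unitary.mem_iff.1 hv
  have h : star (u * star v) * a * (u * star v) - b =
      v * (star u * a * u - star v * b * v) * star v := by
    have : b = v * star v * b * (v * star v) := by simp [hv2]
    conv_lhs => rw [this]
    simp only [star_mul, star_star]
    noncomm_ring
  rw [h, CStarRing.norm_mul_mem_unitary _ (Unitary.star_mem hv),
    CStarRing.norm_mem_unitary_mul _ hv]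

/-- Changing one factor at a time costs `δ‖a‖` on the left, where `‖u‖ = 1`, and `2δ‖a‖` on the
right, where `‖z‖ ≤ 1 + δ ≤ 2`. -/
theorem norm_conj_sub_conj_le {a u z : A} {δ : ℝ} (hu : u ∈ unitary A) (hδ1 : δ ≤ 1)
    (h : ‖u - z‖ ≤ δ) : ‖star u * a * u - star z * a * z‖ ≤ 3 * δ * ‖a‖ := by
  have hδ0 : 0 ≤ δ := (norm_nonneg _).trans h
  nontriviality A
  have hu1 : ‖u‖ = 1 := CStarRing.norm_of_mem_unitary hu
  have hz : ‖z‖ ≤ 2 := by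
    have := norm_sub_le u (u - z)
    rw [sub_sub_cancel] at this
    linarith
  have h1 : star u * a * u - star z * a * z = star (u - z) * a * u + star z * a * (u - z) := by
    rw [star_sub]
    noncomm_ring
  have h2 : ‖star (u - z) * a * u‖ ≤ δ * ‖a‖ * 1 := by
    rw [← hu1]
    refine (norm_mul₃_le).trans ?_
    rw [norm_star]
    gcongr
  have h3 : ‖star z * a * (u - z)‖ ≤ 2 * ‖a‖ * δ := by
    refine (norm_mul₃_le).trans ?_
    rw [norm_star]
    gcongr
  rw [h1]
  refine (norm_add_le _ _).trans ?_
  linarith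

variable [PartialOrder A] [StarOrderedRing A]

theorem orbitDist_amplify_le (n : ℕ) (a b : A) :
    orbitDist (amplify n a) (amplify n b) ≤ orbitDist a b :=
  le_orbitDist fun u hu v hv => by
    refine (orbitDist_le (Unitary.map_mem (amplifyHom n) hu)
      (Unitary.map_mem (amplifyHom n) hv)).trans ?_
    simp only [← amplifyHom_apply, ← map_star, ← map_mul, ← map_sub]
    exact norm_amplify_le n _

/-- If `A` has a sequence of systems of matrix units such that the elements commuting with all
but finitely many of them are dense, then amplification preserves distances of unitary orbits. -/
theorem orbitDist_amplify_of_dense {n : ℕ} {f : ℕ → Fin n → Fin n → A}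
    (hf : ∀ k, IsMatrixUnits (f k))
    (hd : Dense {x | ∀ᶠ k in Filter.atTop, ∀ i j, Commute (f k i j) x}) (a b : A) :
    orbitDist a b = orbitDist (amplify n a) (amplify n b) := by
  set T := {x | ∀ᶠ k in Filter.atTop, ∀ i j, Commute (f k i j) x} with hT
  refine le_antisymm (le_orbitDist fun U hU V hV => ?_) (orbitDist_amplify_le n a b)
  rw [norm_unitary_conj_sub_unitary_conj hV]
  obtain ⟨W, hW, hWeq⟩ : ∃ W ∈ unitary (CStarMatrix (Fin n) (Fin n) A), U * star V = W :=
    ⟨_, mul_mem hU (Unitary.star_mem hV), rfl⟩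
  rw [hWeq]
  set r := ‖star W * amplify n a * W - amplify n b‖ with hr
  refine le_of_forall_pos_le_add fun ε hε => ?_
  -- `3 * δ * ‖a'‖` will be the cost of replacing `z` by a unitary, and `‖a'‖ ≤ ‖a‖ + ε / 4`.
  obtain ⟨δ, hδ0, hδ1, hδε⟩ : ∃ δ > 0, δ < 1 ∧ 3 * δ * (‖a‖ + ε / 4) ≤ ε / 4 := by
    have hp : 0 < 12 * (‖a‖ + ε / 4) := by positivity
    refine ⟨min (1 / 2) (ε / (12 * (‖a‖ + ε / 4))), by positivity,
      (min_le_left _ _).trans_lt (by norm_num), ?_⟩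
    have := (le_div_iff₀ hp).1 (min_le_right (1 / 2) (ε / (12 * (‖a‖ + ε / 4))))
    linarith
  -- Convergence of matrices is entrywise, so matrices with entries in the dense set `T` are dense.
  have hTd : Dense (CStarMatrix.ofMatrixL (m := Fin n) (n := Fin n) (A := A) ''
      {Z | ∀ i j, Z i j ∈ T}) := by
    refine CStarMatrix.ofMatrixL.surjective.denseRange.dense_image
      CStarMatrix.ofMatrixL.continuous ?_
    have hd' : Dense (Set.pi Set.univ fun _ : Fin n => Set.pi Set.univ fun _ : Fin n => T) :=
      dense_pi Set.univ fun i _ => dense_pi Set.univ fun j _ => hd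
    refine hd'.mono fun Z hZ i j => ?_
    exact hZ i trivial j trivial
  have hca := continuous_amplify (A := A) n
  -- These strict inequalities hold at `(W, a, b)`, hence also at some point of the dense set.
  have hopen : IsOpen {p : CStarMatrix (Fin n) (Fin n) A × A × A |
      ‖star p.1 * p.1 - 1‖ < δ ∧ ‖p.1 * star p.1 - 1‖ < δ ∧
      ‖star p.1 * amplify n p.2.1 * p.1 - amplify n p.2.2‖ < r + ε / 4 ∧
      ‖a - p.2.1‖ < ε / 4 ∧ ‖b - p.2.2‖ < ε / 4} := by
    refine IsOpen.and ?_ (IsOpen.and ?_ (IsOpen.and ?_ (IsOpen.and ?_ ?_))) <;>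
      exact isOpen_lt (by fun_prop) (by fun_prop)
  obtain ⟨⟨_, a', b'⟩, ⟨⟨Z', hZ', rfl⟩, ha', hb'⟩, h1, h2, h3, h4, h5⟩ :=
    (hTd.prod (hd.prod hd)).exists_mem_open hopen ⟨(W, a, b), by
      simp [Unitary.star_mul_self_of_mem hW, Unitary.mul_star_self_of_mem hW, hδ0, hε, hr]⟩
  have hZ : ∀ᶠ k in Filter.atTop, ∀ i j p q, Commute (f k p q) (Z' i j) := by
    simp only [Filter.eventually_all]
    intro i j
    simpa only [Filter.eventually_all] using (show ∀ᶠ k in _, _ from hZ' i j)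
  -- Only finitely many elements are involved, so one `k` serves them all.
  obtain ⟨k, hka, hkb, hkZ⟩ := (ha'.and (hb'.and hZ)).exists
  set Z : CStarMatrix (Fin n) (Fin n) A := CStarMatrix.ofMatrixL Z'
  simp only at h1 h2 h3 h4 h5
  let Zs : entryCommutant (f k) := ⟨Z, (mem_entryCommutant (hf k)).2 fun p q i j => hkZ i j p q⟩
  let as : entryCommutant (f k) := ⟨amplify n a', amplify_mem_entryCommutant (hf k) hka⟩
  let bs : entryCommutant (f k) := ⟨amplify n b', amplify_mem_entryCommutant (hf k) hkb⟩
  let Ψ := (hf k).collapse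
  have hΨ : ∀ X, ‖Ψ X‖ ≤ ‖X.1‖ := (hf k).norm_collapse_le
  have hΨa : Ψ as = a' := (hf k).collapse_amplify _
  have hΨb : Ψ bs = b' := (hf k).collapse_amplify _
  set z := Ψ Zs with hz
  have e1 : ‖star z * z - 1‖ < δ := by
    have := hΨ (star Zs * Zs - 1)
    rw [map_sub, map_mul, map_star, map_one] at this
    exact this.trans_lt h1
  have e2 : ‖z * star z - 1‖ < δ := by
    have := hΨ (Zs * star Zs - 1)
    rw [map_sub, map_mul, map_star, map_one] at this
    exact this.trans_lt h2
  have e3 : ‖star z * a' * z - b'‖ < r + ε / 4 := by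
    have := hΨ (star Zs * as * Zs - bs)
    rw [map_sub, map_mul, map_mul, map_star, hΨa, hΨb] at this
    exact this.trans_lt h3
  obtain ⟨w, hw, hwz⟩ := exists_unitary_norm_sub_le hδ1 e1.le (e2.trans hδ1)
  have e4 := norm_conj_sub_conj_le (a := a') hw hδ1.le hwz
  have e5 : ‖a'‖ ≤ ‖a‖ + ε / 4 := by
    have := norm_sub_le a (a - a')
    rw [sub_sub_cancel] at this
    linarith
  have e6 : 3 * δ * ‖a'‖ ≤ ε / 4 := le_trans (by gcongr) hδε
  have e7 : ‖star w * (a - a') * w‖ = ‖a - a'‖ := by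
    rw [CStarRing.norm_mul_mem_unitary _ hw, CStarRing.norm_mem_unitary_mul _ (Unitary.star_mem hw)]
  -- The four terms contribute `ε / 4`, `ε / 4`, `r + ε / 4` and `ε / 4`.
  have e8 : star w * a * w - b = star w * (a - a') * w +
      ((star w * a' * w - star z * a' * z) + ((star z * a' * z - b') + -(b - b'))) := by
    noncomm_ring
  have e9 := orbitDist_le (a := a) (b := b) hw (one_mem (unitary A))
  rw [star_one, one_mul, mul_one, e8] at e9
  refine e9.trans ((norm_add_le _ _).trans ?_)
  rw [e7]
  have e10 := norm_add_le (star w * a' * w - star z * a' * z) ((star z * a' * z - b') + -(b - b'))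
  have e11 := norm_add_le (star z * a' * z - b') (-(b - b'))
  rw [norm_neg] at e11
  linarith

end OrbitDist

/-! ## Matrix units in the UHF algebra and in its tensor products -/

section CStarSeminorm

variable {R : Type*} [Ring R] [StarRing R] [Algebra ℂ R]

/-- The canonical map into the completion, as a star-homomorphism. -/
def CStarSeminorm.ofHom (p : CStarSeminorm R) : R →⋆ₐ[ℂ] p.Compl where
  toFun := Compl.of p
  map_one' := rfl
  map_mul' := Compl.of_mul p
  map_zero' := rfl
  map_add' := Compl.of_add p
  commutes' r := by
    rw [Algebra.algebraMap_eq_smul_one, Algebra.algebraMap_eq_smul_one]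
    exact Compl.of_smul p r 1
  map_star' := Compl.of_star p

theorem CStarSeminorm.norm_ofHom (p : CStarSeminorm R) (x : R) :
    ‖p.ofHom x‖ = p.toSeminorm x := Compl.norm_of p x

theorem CStarSeminorm.denseRange_ofHom (p : CStarSeminorm R) : DenseRange p.ofHom :=
  Compl.denseRange_of p

end CStarSeminorm

theorem IsMatrixUnits.map {R S : Type*} [Ring R] [StarRing R] [Algebra ℂ R] [Ring S] [StarRing S]
    [Algebra ℂ S] {n : ℕ} {f : Fin n → Fin n → R} (hf : IsMatrixUnits f) (φ : R →⋆ₐ[ℂ] S) :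
    IsMatrixUnits fun i j => φ (f i j) where
  mul i j k l := by
    rw [← map_mul, hf.mul]
    split_ifs <;> simp
  star i j := by rw [← map_star, hf.star]
  sum_diag := by rw [← map_sum, hf.sum_diag, map_one]

/-! ### Matrix units acting on one letter of a word. -/

namespace MatPow

open scoped ComplexOrder

/-- The matrix unit `e i j` acting on the letter `k` of the words of length `m`; zero if there is
no such letter. -/
def letterUnit (n k : ℕ) (i j : Fin n) (m : ℕ) : MatPow n m :=
  CStarMatrix.ofMatrix fun v w =>
    if h : k < m then if v ⟨k, h⟩ = i ∧ w = Function.update v ⟨k, h⟩ j then 1 else 0 else 0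

theorem letterUnit_of_le {n k m : ℕ} (h : m ≤ k) (i j : Fin n) : letterUnit n k i j m = 0 := by
  ext v w
  exact dif_neg h.not_gt

theorem letterUnit_apply {n k m : ℕ} (h : k < m) (i j : Fin n) (v w : Fin m → Fin n) :
    letterUnit n k i j m v w =
      if v ⟨k, h⟩ = i ∧ w = Function.update v ⟨k, h⟩ j then 1 else 0 :=
  dif_pos h

theorem letterUnit_mul (n k m : ℕ) (i j p q : Fin n) :
    letterUnit n k i j m * letterUnit n k p q m = if j = p then letterUnit n k i q m else 0 := by
  rcases lt_or_ge k m with h | h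
  · ext v w
    rw [CStarMatrix.mul_apply, Finset.sum_eq_single (Function.update v ⟨k, h⟩ j)]
    · split_ifs with hj
      · by_cases hv : v ⟨k, h⟩ = i <;> simp [letterUnit_apply h, hj, hv]
      · simp [letterUnit_apply h, hj]
    · intro x _ hx
      simp [letterUnit_apply h, hx]
    · simp
  · simp [letterUnit_of_le h]

theorem letterUnit_star (n k m : ℕ) (i j : Fin n) :
    star (letterUnit n k i j m) = letterUnit n k j i m := by
  rcases lt_or_ge k m with h | h
  · ext v w
    have hiff : (w ⟨k, h⟩ = i ∧ v = Function.update w ⟨k, h⟩ j) ↔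
        (v ⟨k, h⟩ = j ∧ w = Function.update v ⟨k, h⟩ i) := by
      constructor <;> rintro ⟨rfl, rfl⟩ <;> simp
    rw [CStarMatrix.star_apply, letterUnit_apply h, letterUnit_apply h]
    simp only [hiff]
    split_ifs <;> simp
  · simp [letterUnit_of_le h]

theorem sum_letterUnit {n k m : ℕ} (h : k < m) : ∑ i, letterUnit n k i i m = 1 := by
  ext v w
  have hs : ∀ s : Finset (Fin n), (∑ i ∈ s, letterUnit n k i i m) v w =
      ∑ i ∈ s, letterUnit n k i i m v w := fun s => by
    induction s using Finset.induction_on with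
    | empty => simp
    | insert i s hi ih => rw [Finset.sum_insert hi, Finset.sum_insert hi, CStarMatrix.add_apply, ih]
  rw [hs, Finset.sum_eq_single (v ⟨k, h⟩)]
  · simp [letterUnit_apply h, CStarMatrix.one_apply, eq_comm]
  · intro i _ hi
    simp [letterUnit_apply h, hi.symm]
  · simp

theorem embed_letterUnit {n k m : ℕ} (h : k < m) (i j : Fin n) :
    embed n m (letterUnit n k i j m) = letterUnit n k i j (m + 1) := by
  ext v w
  change embedFun n m _ v w = _
  rw [embedFun_apply, letterUnit_apply h, letterUnit_apply (h.trans m.lt_succ_self)]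
  have hk : (⟨k, h.trans m.lt_succ_self⟩ : Fin (m + 1)) = Fin.castSucc ⟨k, h⟩ := rfl
  have hne : Fin.last m ≠ Fin.castSucc ⟨k, h⟩ := (Fin.castSucc_lt_last _).ne'
  rw [← ite_and]
  refine if_congr ?_ rfl rfl
  rw [hk, word_ext_iff w, Fin.init_update_castSucc, Function.update_of_ne hne,
    eq_comm (a := v (Fin.last m))]
  exact ⟨fun ⟨a, b, c⟩ => ⟨b, c, a⟩, fun ⟨a, b, c⟩ => ⟨c, a, b⟩⟩

/-- The two matrices act on different tensor factors. In coordinates each product has a single term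
that can be nonzero: at `v` with last letter `j`, respectively at `w` with last letter `i`. -/
theorem commute_letterUnit_embed (n k : ℕ) (i j : Fin n) (x : MatPow n k) :
    Commute (letterUnit n k i j (k + 1)) (embed n k x) := by
  have hl : (⟨k, k.lt_succ_self⟩ : Fin (k + 1)) = Fin.last k := rfl
  ext v w
  rw [CStarMatrix.mul_apply, CStarMatrix.mul_apply,
    Finset.sum_eq_single (Function.update v (Fin.last k) j),
    Finset.sum_eq_single (Function.update w (Fin.last k) i)]
  · change _ * embedFun n k x _ _ = embedFun n k x _ _ * _
    simp only [embedFun_apply, letterUnit_apply k.lt_succ_self, hl]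
    by_cases h1 : v (Fin.last k) = i <;> by_cases h2 : w (Fin.last k) = j <;>
      simp [h1, h2, eq_comm (a := j)]
  · intro y _ hy
    have h0 : letterUnit n k i j (k + 1) y w = 0 := by
      rw [letterUnit_apply k.lt_succ_self, if_neg]
      rw [hl]
      rintro ⟨rfl, rfl⟩
      simp at hy
    exact (congrArg _ h0).trans (mul_zero _)
  · simp
  · intro y _ hy
    have h0 : letterUnit n k i j (k + 1) v y = 0 := by
      simp [letterUnit_apply k.lt_succ_self, hl, hy]
    exact (congrArg (· * _) h0).trans (zero_mul _)
  · simp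

end MatPow

/-! ### An asymptotically central sequence of matrix units in the UHF algebra. -/

namespace UHF

open CStarSeminorm
open scoped ComplexOrder

/-- The matrix units at the letter `k`, as eventually coherent sequences. -/
def unitThread (n k : ℕ) (i j : Fin n) : SeqLimit.threads (MatPow n) (MatPow.embed n) :=
  -- Words contain the letter `k` only from length `k + 1` on; the earlier terms are zero, so
  -- coherence starts there.
  ⟨MatPow.letterUnit n k i j, k + 1, fun _ hm => (MatPow.embed_letterUnit hm i j).symm⟩

/-- The norm is a limit along the sequence and sees only tails. This is needed because the diagonal
units at letter `k` sum to `1` only in lengths above `k`. -/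
theorem limit_eq_of_eventually {n : ℕ} {x y : SeqLimit.threads (MatPow n) (MatPow.embed n)}
    (h : ∀ᶠ m in Filter.atTop, x.1 m = y.1 m) :
    (SeqLimit.seminorm (MatPow n) (MatPow.embed n)).ofHom x =
      (SeqLimit.seminorm (MatPow n) (MatPow.embed n)).ofHom y := by
  rw [← sub_eq_zero, ← norm_eq_zero, ← map_sub, norm_ofHom]
  refine tendsto_nhds_unique (SeqLimit.tendsto_norm _ _ _)
    (tendsto_const_nhds.congr' (h.mono fun m hm => ?_))
  change 0 = ‖x.1 m - y.1 m‖
  simp [hm]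

/-- Once `x` is coherent from `k` on, its term at `k + 1` is `x k ⊗ 1`, which commutes with units at
the letter `k`; embeddings preserve this, and in lengths up to `k` the unit is zero. -/
theorem eventually_commute (n : ℕ) (x : SeqLimit.threads (MatPow n) (MatPow.embed n)) :
    ∀ᶠ k in Filter.atTop, ∀ i j, unitThread n k i j * x = x * unitThread n k i j := by
  obtain ⟨K, hK⟩ := x.2
  filter_upwards [Filter.eventually_ge_atTop K] with k hk i j
  refine Subtype.ext (funext fun m => ?_)
  change MatPow.letterUnit n k i j m * x.1 m = x.1 m * MatPow.letterUnit n k i j m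
  rcases lt_or_ge k m with h | h
  · induction m, h using Nat.le_induction with
    | base =>
      rw [hK k hk]
      exact MatPow.commute_letterUnit_embed n k i j _
    | succ m hm ih =>
      rw [hK m (by omega), ← MatPow.embed_letterUnit hm, ← map_mul, ih, map_mul]
  · simp [MatPow.letterUnit_of_le h]

/-- The matrix units at the letter `k`. -/
def unit (n k : ℕ) (i j : Fin n) : UHF n :=
  (SeqLimit.seminorm (MatPow n) (MatPow.embed n)).ofHom (unitThread n k i j)

theorem isMatrixUnits_unit (n k : ℕ) : IsMatrixUnits (unit n k) where
  mul i j p q := by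
    have h : unitThread n k i j * unitThread n k p q =
        if j = p then unitThread n k i q else 0 := by
      refine Subtype.ext (funext fun m => (MatPow.letterUnit_mul n k m i j p q).trans ?_)
      split_ifs <;> rfl
    rw [unit, unit, ← map_mul, h]
    split_ifs <;> simp [unit]
  star i j := by
    rw [unit, ← StarHomClass.map_star]
    exact congrArg _ (Subtype.ext (funext fun m => MatPow.letterUnit_star n k m i j))
  sum_diag := by
    simp only [unit]
    rw [← map_sum, ← map_one (SeqLimit.seminorm (MatPow n) (MatPow.embed n)).ofHom]
    refine limit_eq_of_eventually ?_
    filter_upwards [Filter.eventually_gt_atTop k] with m hm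
    rw [AddSubmonoidClass.coe_finsetSum, Finset.sum_apply]
    exact MatPow.sum_letterUnit hm

theorem dense_eventually_commute (n : ℕ) :
    Dense {x : UHF n | ∀ᶠ k in Filter.atTop, ∀ i j, Commute (unit n k i j) x} := by
  refine (denseRange_ofHom _).mono ?_
  rintro _ ⟨x, rfl⟩
  filter_upwards [eventually_commute n x] with k hk i j
  exact (show Commute (unitThread n k i j) x from hk i j).map _

end UHF

/-! ### Passage of eventual commutation to the minimal tensor product. -/

section MinTensor

open CStarSeminorm

variable {A : Type u} {B : Type v} [CStarAlgebra A] [CStarAlgebra B]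

theorem minNorm_tmul_le (a : A) (b : B) : minNorm (a ⊗ₜ[ℂ] b) ≤ ‖a‖ * ‖b‖ :=
  minNorm_le (by positivity) fun H _ _ _ K _ _ _ π σ => by
    rw [repTensor_tmul]
    refine (norm_opTensor_le _ _).trans ?_
    gcongr
    · exact NonUnitalStarAlgHom.norm_apply_le π a
    · exact NonUnitalStarAlgHom.norm_apply_le σ b

theorem continuous_minTensor_left (b : B) :
    Continuous fun a : A => (minSeminorm A B).ofHom (a ⊗ₜ[ℂ] b) := by
  refine AddMonoidHomClass.continuous_of_bound
    ((minSeminorm A B).ofHom.toLinearMap ∘ₗ (TensorProduct.mk ℂ A B).flip b) ‖b‖ fun a => ?_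
  change ‖(minSeminorm A B).ofHom (a ⊗ₜ[ℂ] b)‖ ≤ _
  rw [norm_ofHom, mul_comm]
  exact minNorm_tmul_le a b

/-- The canonical unital embedding `a ↦ a ⊗ 1`. -/
def minTensorLeft : A →⋆ₐ[ℂ] MinTensorProduct A B :=
  (minSeminorm A B).ofHom.comp
    { Algebra.TensorProduct.includeLeft (R := ℂ) (S := ℂ) (A := A) (B := B) with
      map_star' := fun a => by
        change star a ⊗ₜ[ℂ] (1 : B) = star (a ⊗ₜ[ℂ] 1)
        rw [TensorProduct.star_tmul, star_one] }

/-- The elements that commute with all but finitely many members of a sequence of families. -/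
def eventualCommutant {ι R : Type*} [Ring R] (f : ℕ → ι → R) : AddSubgroup R where
  carrier := {x | ∀ᶠ k in Filter.atTop, ∀ i, Commute (f k i) x}
  add_mem' hx hy := by
    filter_upwards [hx, hy] with k h1 h2 i using (h1 i).add_right (h2 i)
  zero_mem' := Filter.Eventually.of_forall fun k i => Commute.zero_right _
  neg_mem' hx := by
    filter_upwards [hx] with k h1 i using (h1 i).neg_right

/-- If `f k i` commutes with `a'`, then `f k i ⊗ 1` commutes with `a' ⊗ b`. Such tensors approximate
`a ⊗ b`, and the closure of an additive subgroup is closed under sums, so it contains the whole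
algebraic tensor product. -/
theorem dense_eventualCommutant_minTensor {ι : Type*} {f : ℕ → ι → A}
    (hf : Dense (eventualCommutant f : Set A)) :
    Dense (eventualCommutant (fun k i => minTensorLeft (B := B) (f k i)) :
      Set (MinTensorProduct A B)) := by
  set T := eventualCommutant (fun k i => minTensorLeft (B := B) (f k i)) with hT
  have hmem : ∀ x : A ⊗[ℂ] B, (minSeminorm A B).ofHom x ∈ T.topologicalClosure := fun x => by
    induction x using TensorProduct.induction_on with
    | zero => rw [map_zero]; exact zero_mem _
    | add x y hx hy => rw [map_add]; exact add_mem hx hy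
    | tmul a b =>
      refine (map_mem_closure (continuous_minTensor_left b) (hf a) fun a' ha' => ?_ :)
      filter_upwards [ha'] with k hk i
      refine Commute.map ?_ (minSeminorm A B).ofHom
      change (f k i ⊗ₜ[ℂ] (1 : B)) * (a' ⊗ₜ[ℂ] b) = (a' ⊗ₜ[ℂ] b) * (f k i ⊗ₜ[ℂ] (1 : B))
      rw [Algebra.TensorProduct.tmul_mul_tmul, Algebra.TensorProduct.tmul_mul_tmul, (hk i).eq,
        one_mul, mul_one]
  have := (denseRange_ofHom (minSeminorm A B)).mono (Set.range_subset_iff.2 hmem)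
  exact dense_closure.1 this

end MinTensor

end

theorem proposition4p3 {A : Type*} [CStarAlgebra A] [PartialOrder A] [StarOrderedRing A]
    [TopologicalSpace.SeparableSpace A] (n : ℕ) (hn : 1 ≤ n)
    (hA : Nonempty (MinTensorProduct (UHF n) A ≃⋆ₐ[ℂ] A)) (a b : A) :
    orbitDist a b = orbitDist (amplify n a) (amplify n b) := by
  obtain ⟨θ⟩ := hA
  let θ' : MinTensorProduct (UHF n) A →⋆ₐ[ℂ] A := θ
  let φ : UHF n →⋆ₐ[ℂ] A := θ'.comp minTensorLeft
  have hθ : Continuous θ' := AddMonoidHomClass.continuous_of_bound θ' 1 fun x => by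
    rw [one_mul]
    exact NonUnitalStarAlgHom.norm_apply_le θ' x
  refine orbitDist_amplify_of_dense (f := fun k i j => φ (UHF.unit n k i j))
    (fun k => (UHF.isMatrixUnits_unit n k).map φ) ?_ a b
  have hd : Dense (eventualCommutant fun k (p : Fin n × Fin n) => UHF.unit n k p.1 p.2 :
      Set (UHF n)) :=
    (UHF.dense_eventually_commute n).mono fun x hx => hx.mono fun k hk p => hk p.1 p.2
  -- A continuous surjection maps dense sets to dense sets, and a homomorphism preserves
  -- commutation.
  refine ((show Function.Surjective θ' from θ.surjective).denseRange.dense_image hθ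
    (dense_eventualCommutant_minTensor (B := A) hd)).mono ?_
  rintro _ ⟨x, hx, rfl⟩
  exact hx.mono fun k hk i j => (hk (i, j)).map θ'
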